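/- Let $\triangle$ be the Dynkin diagram of a reduced irreducible finite root system $\Phi$ (any type $A$–$G$) with vertex set $I$, simple roots $\alpha_i$, simple coroots $h_i$, Cartan matrix $\mathsf c_{i,j}=\langle h_i,\alpha_j\rangle$, positive roots $\Phi^+$, fundamental weights $\varpi_i$, and the Weyl group invariant symmetric bilinear form $(\cdot,\cdot)$ normalized by $(\alpha,\alpha)=2$ for short roots $\alpha$; put $d_i=(\alpha_i,\alpha_i)/2$. Let $\underline{\mathsf B}(t)=\underline{\mathsf C}(t)\,\mathrm{diag}(d_i)^{-1}$, where $\underline{\mathsf C}(t)$ has diagonal entries $t+t^{-1}$ and off-diagonal entries $\mathsf c_{i,j}$, let $\widetilde{\underline{\mathsf B}}(t)$ be its inverse over $\mathbb Q(t)$, with Laurent expansions $\widetilde{\underline{\mathsf B}}_{i,j}(t)=\sum_u\widetilde{\mathsf b}_{i,j}(u)t^u$ at $t=0$, and set $\widetilde\eta_{i,j}(u)=\widetilde{\mathsf b}_{i,j}(u)+\widetilde{\mathsf b}_{i,j}(-u)$ and $$\underline{\mathcal N}(i,p;j,s)=\widetilde\eta_{i,j}(p-s-1)-\widetilde\eta_{i,j}(p-s+1).$$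 Let $Q=(\triangle,\xi)$ be a Dynkin quiver, i.e. $\xi:I\to\mathbb Z$ satisfies $|\xi_i-\xi_j|=1$ whenever $i,j$ are adjacent in $\triangle$. A vertex $i$ is a source of $\xi$ if $\xi_i>\xi_j$ for all neighbours $j$ of $i$, and $s_i\xi$ is obtained from $\xi$ by replacing $\xi_i$ by $\xi_i-2$. Let $\tau_Q=s_{i_1}\cdots s_{i_n}$ be the unique Coxeter element with a $Q$-adapted expression: $i_1,\dots,i_n$ is an enumeration of $I$ and each $i_k$ is a source of $s_{i_{k-1}}\cdots s_{i_1}\xi$. Put $\gamma_i^Q=(1-\tau_Q)\varpi_i\in\Phi^+$ and $\widehat\triangle_0=\{(i,p)\in I\times\mathbb Z\mid p-\xi_i\in2\mathbb Z\}$, and let $\phi_Q:\widehat\triangle_0\to\Phi^+\times\mathbb Z$ be determined by $\phi_Q(i,\xi_i)=(\gamma_i^Q,0)$ and, if $\phi_Q(i,p)=(\beta,u)$, by $$\phi_Q(i,p\pm2)=\begin{cases}(\tau_Q^{\mp1}\beta,\,u)&\text{if }\tau_Q^{\mp1}\beta\in\Phi^+,\\(-\tau_Q^{\mp1}\beta,\,u\pm1)&\text{if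 }\tau_Q^{\mp1}\beta\in-\Phi^+.\end{cases}$$ Let $\mathcal X_q$ be the $\mathbb Z[q^{\pm1/2}]$-algebra with generators $\widetilde X_{i,p}^{\pm1}$, $(i,p)\in\widehat\triangle_0$, and relations $\widetilde X_{i,p}\widetilde X_{i,p}^{-1}=\widetilde X_{i,p}^{-1}\widetilde X_{i,p}=1$ and $\widetilde X_{i,p}\widetilde X_{j,s}=q^{\underline{\mathcal N}(i,p;j,s)}\widetilde X_{j,s}\widetilde X_{i,p}$. **Theorem.** For every Dynkin quiver $Q$ on $\triangle$ and all $(i,p),(j,s)\in\widehat\triangle_0$ with $\phi_Q(i,p)=(\alpha,k)$ and $\phi_Q(j,s)=(\beta,l)$, $$\underline{\mathcal N}(i,p;j,s)=(-1)^{k+l+\delta(p\ge s)}\,\delta\big((i,p)\ne(j,s)\big)\,(\alpha,\beta),$$ where $\delta(\mathtt P)$ is $1$ if $\mathtt P$ holds and $0$ otherwise. In particular this number is an integer, and it is the exponent of $q$ in the commutation relation of $\widetilde X_{i,p}$ and $\widetilde X_{j,s}$ in $\mathcal X_q$. -/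

import Mathlib

noncomputable section

namespace TQuantized

open RootPairing

set_option linter.unusedSectionVars false

section

variable {ι M N : Type*} [Fintype ι] [AddCommGroup M] [Module ℚ M]
  [AddCommGroup N] [Module ℚ N] {P : RootPairing ι ℚ M N}

/-! ### The finite Cartan datum attached to a root system with a base

The vertex set of the Dynkin diagram is `b.support`; the simple root and the simple coroot at `i`
are `P.root i` and `P.coroot i`. -/

/-- The Cartan matrix `c i j = ⟨h_i, α_j⟩`. -/
def cartan [P.IsCrystallographic] (b : P.Base) (i j : b.support) : ℤ :=
  P.pairingIn ℤ j i

/-- There is an edge between `i` and `j` in the Dynkin diagram, that is `d(i,j) = 1`. -/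
def Adj [P.IsCrystallographic] (b : P.Base) (i j : b.support) : Prop :=
  i ≠ j ∧ cartan b i j < 0

/-- The squared length of the short roots for the canonical Weyl group invariant form
`(x, y) ↦ ∑ k, ⟨x, coroot k⟩ ⟨y, coroot k⟩` (its values on roots are positive integers). -/
def shortNorm (P : RootPairing ι ℚ M N) [P.IsCrystallographic] : ℤ :=
  ⨅ k, (P.posRootForm ℤ).rootLength k

/-- The Weyl group invariant symmetric bilinear form, normalized by `(α, α) = 2` for the short
roots `α` (see `form_shortest`). -/
def form (P : RootPairing ι ℚ M N) [P.IsCrystallographic] : LinearMap.BilinForm ℚ M :=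
  (2 / (shortNorm P : ℚ)) • P.RootForm

lemma form_root_self [P.IsCrystallographic] (k : ι) :
    form P (P.root k) (P.root k) =
      2 * ((P.posRootForm ℤ).rootLength k : ℚ) / (shortNorm P : ℚ) := by
  have h : (((P.posRootForm ℤ).rootLength k : ℤ) : ℚ) = P.RootForm (P.root k) (P.root k) :=
    P.algebraMap_posRootForm_posForm ℤ (P.rootSpanMem ℤ k) (P.rootSpanMem ℤ k)
  rw [h]
  simp [form]
  ring

/-- The minimum of `(α, α)` over all roots `α` is attained and equal to `2`. -/
lemma form_shortest [P.IsCrystallographic] [Nonempty ι] :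
    (∃ k, form P (P.root k) (P.root k) = 2) ∧ ∀ k, 2 ≤ form P (P.root k) (P.root k) := by
  obtain ⟨k₀, h₀⟩ := exists_eq_ciInf_of_finite (f := fun k => (P.posRootForm ℤ).rootLength k)
  have hpos : (0 : ℚ) < (shortNorm P : ℚ) := by
    have := (P.posRootForm ℤ).rootLength_pos k₀
    rw [shortNorm, ← h₀]
    exact_mod_cast this
  refine ⟨⟨k₀, ?_⟩, fun k => ?_⟩
  · have h1 : (P.posRootForm ℤ).rootLength k₀ = shortNorm P := h₀
    rw [form_root_self, h1]
    field_simp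
  · have h1 : shortNorm P ≤ (P.posRootForm ℤ).rootLength k := ciInf_le (Set.finite_range _).bddBelow k
    have h2 : (shortNorm P : ℚ) ≤ ((P.posRootForm ℤ).rootLength k : ℚ) := by exact_mod_cast h1
    rw [form_root_self, le_div_iff₀ hpos]
    linarith

/-- `d_i = (α_i, α_i) / 2`. -/
def dd [P.IsCrystallographic] (b : P.Base) (i : b.support) : ℚ :=
  form P (P.root i) (P.root i) / 2

/-- The fundamental weight `ϖ_i`, characterized by `⟨h_j, ϖ_i⟩ = δ(i = j)`. -/
def varpi [P.IsRootSystem] (b : P.Base) (i : b.support) : M :=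
  P.toPerfPair.symm (b.toCoweightBasis.coord i)

lemma coroot_varpi [P.IsRootSystem] [DecidableEq ι] (b : P.Base) (i j : b.support) :
    P.toLinearMap (varpi b i) (P.coroot j) = if i = j then 1 else 0 := by
  rw [varpi, LinearMap.apply_symm_toPerfPair_self]
  rw [← b.toCoweightBasis_apply j]
  simp [Finsupp.single_apply, eq_comm]

/-- The set `Φ⁺` of positive roots (recorded through their indices). -/
abbrev PosRoot (b : P.Base) : Type _ := {k : ι // b.IsPos k}

/-- The simple reflection `s_i` in the Weyl group. -/
def srefl (b : P.Base) (i : b.support) : P.weylGroup := weylGroup.ofIdx P (i : ι)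

/-- The element `s_{i_1} ⋯ s_{i_l}` of the Weyl group given by a word `[i_1, …, i_l]`. -/
def wordProd (b : P.Base) (l : List b.support) : P.weylGroup := (l.map (srefl b)).prod

lemma root_weyl_smul (w : P.weylGroup) (k : ι) : P.root (w • k) = w • P.root k :=
  RootPairing.Equiv.root_indexEquiv_eq_smul P k (w : P.Aut)

/-! ### Dynkin quivers -/

/-- A Dynkin quiver: the Dynkin diagram together with a height function. -/
structure DynkinQuiver [P.IsCrystallographic] (b : P.Base) where
  ξ : b.support → ℤ
  abs_sub_eq_one : ∀ i j, Adj b i j → |ξ i - ξ j| = 1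

/-- The vertex set `{(i, p) | p - ξ_i ∈ 2ℤ}` of the repetition quiver of `Q`. -/
abbrev Vertex [P.IsCrystallographic] {b : P.Base} (Q : DynkinQuiver b) : Type _ :=
  {x : b.support × ℤ // Even (x.2 - Q.ξ x.1)}

/-- `i` is a source for the height function `ξ`. -/
def IsSource [P.IsCrystallographic] (b : P.Base) (ξ : b.support → ℤ) (i : b.support) : Prop :=
  ∀ j, Adj b i j → ξ j < ξ i

/-- The height function `s_i ξ`. -/
def reflHeight [DecidableEq ι] (b : P.Base) (i : b.support) (ξ : b.support → ℤ) :
    b.support → ℤ :=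
  fun j => ξ j - (if i = j then 1 else 0) * 2

/-- The word `[i_1, …, i_l]` is adapted to `ξ`: each `i_k` is a source of
`s_{i_{k-1}} ⋯ s_{i_1} ξ`. -/
def IsAdapted [DecidableEq ι] [P.IsCrystallographic] (b : P.Base) :
    (b.support → ℤ) → List b.support → Prop
  | _, [] => True
  | ξ, i :: l => IsSource b ξ i ∧ IsAdapted b (reflHeight b i ξ) l

/-- `τ` is a Coxeter element (a product of all the simple reflections, each one occurring once)
having an expression adapted to `Q`. -/
def IsAdaptedCoxeter [DecidableEq ι] [P.IsCrystallographic] {b : P.Base} (Q : DynkinQuiver b)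
    (τ : P.weylGroup) : Prop :=
  ∃ l : List b.support, l.Nodup ∧ (∀ i, i ∈ l) ∧ IsAdapted b Q.ξ l ∧ wordProd b l = τ

section Coxeter

variable [DecidableEq ι] [P.IsCrystallographic] {b : P.Base}

lemma adj_symm {i j : b.support} (h : Adj b i j) : Adj b j i := by
  refine ⟨h.1.symm, ?_⟩
  have h1 := b.cartanMatrix_le_zero_of_ne i j h.1
  have h2 : b.cartanMatrix i j ≠ 0 := by
    intro h0
    have := b.cartanMatrix_apply_eq_zero_iff_symm.mp h0
    have h3 : b.cartanMatrix j i < 0 := h.2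
    lia
  exact lt_of_le_of_ne h1 h2

lemma srefl_comm {i j : b.support} (h : ¬ Adj b i j) :
    srefl b i * srefl b j = srefl b j * srefl b i := by
  by_cases hij : i = j
  · rw [hij]
  have h0 : b.cartanMatrix j i = 0 := by
    have h1 := b.cartanMatrix_le_zero_of_ne j i (Ne.symm hij)
    by_contra h2
    exact h ⟨hij, lt_of_le_of_ne h1 h2⟩
  have h3 : P.IsOrthogonal (i : ι) j := by
    refine IsOrthogonal.symm (isOrthogonal_iff_pairing_eq_zero.mpr ?_)
    exact b.cartanMatrix_apply_eq_zero_iff_pairing.mp h0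
  refine Subtype.ext (RootPairing.Equiv.weightHom_injective P ?_)
  have h4 := isOrthogonal_comm P _ _ h3
  ext x
  exact LinearEquiv.congr_fun h4.eq x

lemma exists_isAdapted_aux (ξ : b.support → ℤ) (l : List b.support) (hn : l.Nodup)
    (hs : l.Pairwise fun i j => ξ j ≤ ξ i)
    (hin : ∀ i ∈ l, ∀ j ∈ l, Adj b i j → |ξ i - ξ j| = 1)
    (hout : ∀ i ∈ l, ∀ j, j ∉ l → Adj b i j → ξ j < ξ i) : IsAdapted b ξ l := by
  induction l generalizing ξ with
  | nil => trivial
  | cons a t ih =>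
    rw [List.nodup_cons] at hn
    rw [List.pairwise_cons] at hs
    have hval : ∀ k, k ≠ a → reflHeight b a ξ k = ξ k := by
      intro k hk
      simp [reflHeight, Ne.symm hk]
    have hvala : reflHeight b a ξ a = ξ a - 2 := by simp [reflHeight]
    have hne : ∀ k ∈ t, k ≠ a := fun k hk h => hn.1 (h ▸ hk)
    refine ⟨?_, ih _ hn.2 ?_ ?_ ?_⟩
    · intro j hj
      by_cases hjl : j ∈ a :: t
      · have h1 := hin a (by simp) j hjl hj
        have hjt : j ∈ t := by
          rcases List.mem_cons.mp hjl with h | h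
          · exact absurd h.symm hj.1
          · exact h
        have h2 := hs.1 j hjt
        rcases h2.lt_or_eq with h | h
        · exact h
        · simp [h] at h1
      · exact hout a (by simp) j hjl hj
    · refine hs.2.imp_of_mem ?_
      intro i j hi hj h
      rw [hval i (hne i hi), hval j (hne j hj)]
      exact h
    · intro i hi j hj hadj
      rw [hval i (hne i hi), hval j (hne j hj)]
      exact hin i (by simp [hi]) j (by simp [hj]) hadj
    · intro i hi j hj hadj
      rw [hval i (hne i hi)]
      by_cases hja : j = a
      · rw [hja, hvala]
        have := hin i (by simp [hi]) a (by simp) (hja ▸ hadj)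
        have := (abs_le.mp this.le).1
        lia
      · rw [hval j hja]
        exact hout i (by simp [hi]) j (by simp [hja, hj]) hadj

lemma exists_isAdaptedCoxeter (Q : DynkinQuiver b) : ∃ τ, IsAdaptedCoxeter Q τ := by
  classical
  let l : List b.support := (Finset.univ : Finset b.support).toList.mergeSort
    (fun i j => decide (Q.ξ j ≤ Q.ξ i))
  have hp : l.Perm (Finset.univ : Finset b.support).toList := List.mergeSort_perm _ _
  have hmem : ∀ i, i ∈ l := fun i => hp.mem_iff.mpr (by simp)
  refine ⟨_, l, hp.nodup_iff.mpr (Finset.nodup_toList _), hmem, ?_, rfl⟩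
  refine exists_isAdapted_aux _ _ (hp.nodup_iff.mpr (Finset.nodup_toList _)) ?_ ?_ ?_
  · have := List.pairwise_mergeSort (le := fun i j : b.support => decide (Q.ξ j ≤ Q.ξ i))
      (by intro a c d; simp; lia) (by intro a c; simp; lia)
      (Finset.univ : Finset b.support).toList
    exact this.imp fun h => by simpa using h
  · intro i _ j _ h
    exact Q.abs_sub_eq_one i j h
  · intro i _ j hj
    exact absurd (hmem j) hj

lemma reflHeight_comm (i j : b.support) (ξ : b.support → ℤ) :
    reflHeight b i (reflHeight b j ξ) = reflHeight b j (reflHeight b i ξ) := by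
  funext k
  simp only [reflHeight]
  ring

lemma isSource_reflHeight {ξ : b.support → ℤ} {i a : b.support} (hia : i ≠ a)
    (hi : IsSource b ξ i) : IsSource b (reflHeight b a ξ) i := by
  intro j hj
  have := hi j hj
  simp only [reflHeight, Ne.symm hia, if_false]
  split_ifs <;> lia

lemma isAdapted_erase (ξ : b.support → ℤ) (l : List b.support) (i : b.support) (hil : i ∈ l)
    (hl : IsAdapted b ξ l) (hi : IsSource b ξ i) :
    wordProd b l = srefl b i * wordProd b (l.erase i) ∧
      IsAdapted b (reflHeight b i ξ) (l.erase i) := by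
  induction l generalizing ξ with
  | nil => simp at hil
  | cons a t ih =>
    by_cases hia : i = a
    · subst hia
      simp only [List.erase_cons_head]
      exact ⟨by simp [wordProd], hl.2⟩
    · have hit : i ∈ t := (List.mem_cons.mp hil).resolve_left hia
      obtain ⟨h1, h2⟩ := ih _ hit hl.2 (isSource_reflHeight hia hi)
      have hnadj : ¬ Adj b a i := by
        intro h
        have h3 := hl.1 i h
        have h4 := hi a (adj_symm h)
        lia
      have he : (a :: t).erase i = a :: t.erase i := by
        rw [List.erase_cons_tail]
        simpa using Ne.symm hia
      rw [he]
      refine ⟨?_, isSource_reflHeight (Ne.symm hia) hl.1, ?_⟩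
      · have e1 : wordProd b (a :: t) = srefl b a * wordProd b t := by simp [wordProd]
        have e2 : wordProd b (a :: t.erase i) = srefl b a * wordProd b (t.erase i) := by
          simp [wordProd]
        rw [e1, e2, h1, ← mul_assoc, srefl_comm hnadj, mul_assoc]
      · rw [reflHeight_comm]
        exact h2

lemma wordProd_eq_of_perm (ξ : b.support → ℤ) (l l' : List b.support) (hp : l.Perm l')
    (hl : IsAdapted b ξ l) (hl' : IsAdapted b ξ l') : wordProd b l = wordProd b l' := by
  induction l' generalizing ξ l with
  | nil => rw [hp.eq_nil]
  | cons a t ih =>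
    have ha : a ∈ l := hp.mem_iff.mpr (by simp)
    obtain ⟨h1, h2⟩ := isAdapted_erase ξ l a ha hl hl'.1
    have hp' : (l.erase a).Perm t := by simpa using hp.erase a
    rw [h1, ih _ _ hp' h2 hl'.2]
    simp [wordProd]

/-- There is exactly one Coxeter element having an expression adapted to `Q`. -/
lemma existsUnique_isAdaptedCoxeter (Q : DynkinQuiver b) : ∃! τ, IsAdaptedCoxeter Q τ := by
  obtain ⟨τ, hτ⟩ := exists_isAdaptedCoxeter Q
  refine ⟨τ, hτ, ?_⟩
  rintro τ' ⟨l', hn', hm', ha', rfl⟩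
  obtain ⟨l, hn, hm, ha, rfl⟩ := hτ
  refine wordProd_eq_of_perm Q.ξ l' l ?_ ha' ha
  rw [List.perm_ext_iff_of_nodup hn' hn]
  intro i
  simp [hm, hm']

/-- The Coxeter element `τ_Q`. -/
def coxeter (Q : DynkinQuiver b) : P.weylGroup := (existsUnique_isAdaptedCoxeter Q).choose

lemma coxeter_spec (Q : DynkinQuiver b) : IsAdaptedCoxeter Q (coxeter Q) :=
  (existsUnique_isAdaptedCoxeter Q).choose_spec.1

end Coxeter

/-! ### The map `φ_Q` -/

section Phi

variable [DecidableEq ι] [P.IsRootSystem] [P.IsCrystallographic] [P.IsReduced] {b : P.Base}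

lemma srefl_smul (i : b.support) (x : M) :
    srefl b i • x = x - P.toLinearMap x (P.coroot i) • P.root i := by
  change P.reflection i x = _
  rw [P.reflection_apply]
  rfl

lemma srefl_varpi_of_ne {i j : b.support} (h : i ≠ j) : srefl b j • varpi b i = varpi b i := by
  rw [srefl_smul, coroot_varpi, if_neg h, zero_smul, sub_zero]

lemma srefl_varpi_self (i : b.support) :
    srefl b i • varpi b i = varpi b i - P.root i := by
  rw [srefl_smul, coroot_varpi, if_pos rfl, one_smul]

lemma wordProd_cons (l : List b.support) (i : b.support) :
    wordProd b (i :: l) = srefl b i * wordProd b l := by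
  simp [wordProd]

lemma wordProd_append (l l' : List b.support) :
    wordProd b (l ++ l') = wordProd b l * wordProd b l' := by
  simp [wordProd]

lemma wordProd_varpi (l : List b.support) (i : b.support) (h : i ∉ l) :
    wordProd b l • varpi b i = varpi b i := by
  induction l with
  | nil => simp [wordProd]
  | cons a t ih =>
    rw [List.mem_cons, not_or] at h
    rw [wordProd_cons, mul_smul, ih h.2, srefl_varpi_of_ne h.1]

lemma isPos_wordProd_smul (l : List b.support) (i : b.support) (h : i ∉ l) :
    b.IsPos (wordProd b l • (i : ι)) ∧
      b.toWeightBasis.coord i (P.root (wordProd b l • (i : ι))) = 1 := by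
  induction l with
  | nil =>
    simp only [wordProd, List.map_nil, List.prod_nil, one_smul]
    refine ⟨Base.isPos_of_mem_support i.2, ?_⟩
    rw [← b.toWeightBasis_apply i]
    simp
  | cons a t ih =>
    rw [List.mem_cons, not_or] at h
    obtain ⟨h1, h2⟩ := ih h.2
    have ha : b.toWeightBasis.coord i (P.root a) = 0 := by
      rw [← b.toWeightBasis_apply a]
      simp [Ne.symm h.1]
    rw [wordProd_cons, mul_smul]
    refine ⟨?_, ?_⟩
    · refine Base.IsPos.reflectionPerm h1 a.2 ?_
      intro h3
      rw [h3, ha] at h2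
      exact zero_ne_one h2
    · rw [root_weyl_smul, srefl_smul, LinearMap.map_sub, LinearMap.map_smul, ha, smul_zero,
        sub_zero, h2]

/-- `(1 - τ_Q) ϖ_i` is a positive root. -/
lemma exists_gamma (Q : DynkinQuiver b) (i : b.support) :
    ∃ k : PosRoot b, P.root k = varpi b i - coxeter Q • varpi b i := by
  obtain ⟨l, hn, hm, -, hτ⟩ := coxeter_spec Q
  obtain ⟨s, t, rfl⟩ := List.append_of_mem (hm i)
  have hs : i ∉ s := fun h => (List.nodup_append.mp hn).2.2 i h i (by simp) rfl
  have ht : i ∉ t := (List.nodup_cons.mp (List.nodup_append.mp hn).2.1).1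
  refine ⟨⟨wordProd b s • (i : ι), (isPos_wordProd_smul s i hs).1⟩, ?_⟩
  rw [← hτ, wordProd_append, wordProd_cons, mul_smul, mul_smul, wordProd_varpi t i ht,
    srefl_varpi_self, smul_sub, wordProd_varpi s i hs, root_weyl_smul]
  abel

/-- The positive root `γ_i^Q = (1 - τ_Q) ϖ_i`. -/
def gamma (Q : DynkinQuiver b) (i : b.support) : PosRoot b := (exists_gamma Q i).choose

lemma root_gamma (Q : DynkinQuiver b) (i : b.support) :
    P.root (gamma Q i) = varpi b i - coxeter Q • varpi b i :=
  (exists_gamma Q i).choose_spec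

/-- The index of the root `-α_k`. -/
def negIdx (P : RootPairing ι ℚ M N) (k : ι) : ι := P.reflectionPerm k k

lemma root_negIdx (k : ι) : P.root (negIdx P k) = -P.root k := by
  simp [negIdx]

lemma negIdx_negIdx (k : ι) : negIdx P (negIdx P k) = k :=
  P.root.injective (by simp [root_negIdx])

lemma smul_negIdx (w : P.weylGroup) (k : ι) : w • negIdx P k = negIdx P (w • k) :=
  P.root.injective (by rw [root_negIdx, root_weyl_smul, root_weyl_smul, root_negIdx, smul_neg])

lemma isPos_negIdx {k : ι} : b.IsPos (negIdx P k) ↔ ¬ b.IsPos k := Base.IsPos.neg_iff_not b k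

/-- `(β, u) ↦ (w β, u)` if `w β` is positive and `(β, u) ↦ (-w β, u + e)` if `w β` is negative. -/
def move (w : P.weylGroup) (e : ℤ) (x : PosRoot b × ℤ) : PosRoot b × ℤ :=
  open Classical in
  if h : b.IsPos (w • (x.1 : ι)) then (⟨w • (x.1 : ι), h⟩, x.2)
  else (⟨negIdx P (w • (x.1 : ι)), isPos_negIdx.mpr h⟩, x.2 + e)

lemma move_inv_move (w : P.weylGroup) (e : ℤ) (x : PosRoot b × ℤ) :
    move w⁻¹ (-e) (move w e x) = x := by
  obtain ⟨⟨k, hk⟩, u⟩ := x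
  by_cases h : b.IsPos (w • k)
  · simp [move, h, hk]
  · simp [move, h, hk, smul_negIdx, negIdx_negIdx, isPos_negIdx]

/-- The bijection of `Φ⁺ × ℤ` which an element `w` of the Weyl group induces: `(β, u)` is sent to
`(w β, u)` if `w β` is positive and to `(-w β, u - 1)` if `w β` is negative. -/
def hat (w : P.weylGroup) : Equiv.Perm (PosRoot b × ℤ) where
  toFun := move w (-1)
  invFun := move w⁻¹ 1
  left_inv x := by simpa using move_inv_move w (-1) x
  right_inv x := by simpa using move_inv_move w⁻¹ 1 x

/-- The map `φ_Q`, with `φ_Q(i, p) = hat(τ_Q) ^ ((ξ_i - p) / 2) (γ_i^Q, 0)`. It is the map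
determined by the inductive rules `phi_height`, `phi_add_two` and `phi_sub_two` below. -/
def phi (Q : DynkinQuiver b) (x : Vertex Q) : PosRoot b × ℤ :=
  (hat (coxeter Q) ^ ((Q.ξ x.1.1 - x.1.2) / 2)) (gamma Q x.1.1, 0)

lemma phi_height (Q : DynkinQuiver b) (i : b.support) :
    phi Q ⟨(i, Q.ξ i), by simp⟩ = (gamma Q i, 0) := by
  simp [phi]

lemma phi_add_two (Q : DynkinQuiver b) (x y : Vertex Q) (h₁ : y.1.1 = x.1.1)
    (h₂ : y.1.2 = x.1.2 + 2) : phi Q y = move (coxeter Q)⁻¹ 1 (phi Q x) := by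
  have h : (Q.ξ x.1.1 - (x.1.2 + 2)) / 2 = -1 + (Q.ξ x.1.1 - x.1.2) / 2 := by lia
  rw [phi, h₁, h₂, h, zpow_add, zpow_neg_one]
  rfl

lemma phi_sub_two (Q : DynkinQuiver b) (x y : Vertex Q) (h₁ : y.1.1 = x.1.1)
    (h₂ : y.1.2 = x.1.2 - 2) : phi Q y = move (coxeter Q) (-1) (phi Q x) := by
  have h : (Q.ξ x.1.1 - (x.1.2 - 2)) / 2 = 1 + (Q.ξ x.1.1 - x.1.2) / 2 := by lia
  rw [phi, h₁, h₂, h, zpow_add, zpow_one]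
  rfl

end Phi

/-! ### The matrix `B(t)`, its inverse, and the quantum torus -/

section Torus

variable [DecidableEq ι] [P.IsCrystallographic]

/-- The `t`-quantized Cartan matrix `C(t)`, with entries
`δ(i = j) (t + t⁻¹) + δ(i ≠ j) c i j` in `ℚ(t)`. -/
def cartanT (b : P.Base) : Matrix b.support b.support (RatFunc ℚ) :=
  .of fun i j => if i = j then RatFunc.X + RatFunc.X⁻¹ else (cartan b i j : RatFunc ℚ)

/-- `B(t) = C(t) D⁻¹`, where `D = diag(d_i)`. -/
def BT (b : P.Base) : Matrix b.support b.support (RatFunc ℚ) :=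
  cartanT b * Matrix.diagonal fun i => RatFunc.C (dd b i)⁻¹

/-- The coefficient of `t ^ u` in the Laurent expansion at `t = 0` of the `(i, j)` entry of
the inverse of `B(t)`. -/
def btilde (b : P.Base) (i j : b.support) (u : ℤ) : ℚ :=
  (((BT b)⁻¹ i j : RatFunc ℚ) : LaurentSeries ℚ).coeff u

/-- The even function `u ↦ b̃ u + b̃ (-u)`. -/
def etaT (b : P.Base) (i j : b.support) (u : ℤ) : ℚ :=
  btilde b i j u + btilde b i j (-u)

/-- The exponent `𝒩(i,p;j,s)`. -/
def NN (b : P.Base) (i : b.support) (p : ℤ) (j : b.support) (s : ℤ) : ℚ :=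
  etaT b i j (p - s - 1) - etaT b i j (p - s + 1)

/-- The ground ring `ℤ[q^{±1/2}]`, in which `LaurentPolynomial.T m` is `q^{m/2}`. -/
abbrev GroundRing : Type := LaurentPolynomial ℤ

/-- The power `q ^ n`. -/
def qpow (n : ℤ) : GroundRing := LaurentPolynomial.T (2 * n)

/-- The free algebra on symbols `X_{i,p}` (on the left) and `X_{i,p}⁻¹` (on the right). -/
abbrev FreeTorus {b : P.Base} (Q : DynkinQuiver b) : Type _ :=
  FreeAlgebra GroundRing (Vertex Q ⊕ Vertex Q)

/-- The defining relations of the quantum torus. -/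
inductive TorusRel {b : P.Base} (Q : DynkinQuiver b) : FreeTorus Q → FreeTorus Q → Prop
  | mul_inv (x : Vertex Q) :
      TorusRel Q (FreeAlgebra.ι _ (.inl x) * FreeAlgebra.ι _ (.inr x)) 1
  | inv_mul (x : Vertex Q) :
      TorusRel Q (FreeAlgebra.ι _ (.inr x) * FreeAlgebra.ι _ (.inl x)) 1
  | comm (x y : Vertex Q) (n : ℤ) (hn : (n : ℚ) = NN b x.1.1 x.1.2 y.1.1 y.1.2) :
      TorusRel Q (FreeAlgebra.ι _ (.inl x) * FreeAlgebra.ι _ (.inl y))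
        (qpow n • (FreeAlgebra.ι _ (.inl y) * FreeAlgebra.ι _ (.inl x)))

/-- The quantum torus `𝒳_q`. -/
abbrev QuantumTorus {b : P.Base} (Q : DynkinQuiver b) : Type _ := RingQuot (TorusRel Q)

/-- The generator `X_{i,p}` of the quantum torus. -/
def gen {b : P.Base} (Q : DynkinQuiver b) (x : Vertex Q) : QuantumTorus Q :=
  RingQuot.mkAlgHom GroundRing (TorusRel Q) (FreeAlgebra.ι _ (.inl x))

end Torus

end

end TQuantized

end

noncomputable section

namespace TQuantized

open RootPairing

set_option linter.unusedSectionVars false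

/-! ### The invariant form on roots and fundamental weights. -/

section FormFacts

variable {ι M N : Type*} [Fintype ι] [AddCommGroup M] [Module ℚ M]
  [AddCommGroup N] [Module ℚ N] {P : RootPairing ι ℚ M N} [P.IsCrystallographic]

/-! Write τ for the Coxeter element. Both sides of the formula come from one second-order recursion
along the repetition quiver. Put w_j(p) = τ^((ξ_j - p)/2) ϖ_j, or 0 when the parity is wrong, and
r_j(p) = w_j(p) - w_j(p - 2). Expanding α_j in fundamental weights and reading an adapted word for τ
gives the mesh relation w_j(p+1) + w_j(p-1) + ∑_{k≠j} c_kj w_k(p) = 0 (`slideWeight_mesh`), hence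
the same relation for r.

The identity B(t)⁻¹ C(t) = diag(d_i) gives the same recursion for the Laurent coefficients b̃_ij(u),
with a source d_i at i = j, u = 0 (`btilde_mesh`). They vanish for u ≤ 0, and b̃_ij(1) is d_i if i =
j and 0 otherwise. The pairings (ϖ_i, r_j(ξ_i + 1 - u)) have the same values at u = 0 and u = 1, so
the two agree for all u ≥ 0 (`btilde_eq_form`). Matching these initial values is the main work.

For s < p the exponent is a difference of two coefficients, and invariance of the form under τ turns
it into -(r_i(p), r_j(s)) (`NN_eq_neg_form`). Antisymmetry handles p < s. For p = s the exponent is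
0, and the roots of distinct vertices are orthogonal. Finally r_i(p) = (-1)^k α when φ_Q(i,p) =
(α,k) (`signedRoot_phi`), which produces the remaining signs. -/

lemma form_comm (x y : M) : form P x y = form P y x := by
  have h : P.RootForm x y = P.RootForm y x := by simpa using P.rootForm_symmetric.eq x y
  simp [form, h]

lemma form_reflection_reflection (k : ι) (x y : M) :
    form P (P.reflection k x) (P.reflection k y) = form P x y := by
  simp [form, P.rootForm_reflection_reflection_apply]

lemma form_smul_smul (w : P.weylGroup) (x y : M) : form P (w • x) (w • y) = form P x y := by
  obtain ⟨g, hg⟩ := w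
  induction hg using weylGroup.induction generalizing x y with
  | mem k => exact form_reflection_reflection k x y
  | one => rfl
  | mul g h hg hh ihg ihh =>
    have e : (⟨g * h, mul_mem hg hh⟩ : P.weylGroup) = ⟨g, hg⟩ * ⟨h, hh⟩ := rfl
    rw [e, mul_smul, mul_smul, ihg, ihh]

lemma form_smul_left (w : P.weylGroup) (x y : M) : form P (w • x) y = form P x (w⁻¹ • y) := by
  rw [← form_smul_smul w x, smul_inv_smul]

lemma weyl_smul_smul (w : P.weylGroup) (c : ℚ) (x : M) : w • (c • x) = c • (w • x) := by
  exact smul_comm w c x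

lemma form_root_right (x : M) (k : ι) :
    form P x (P.root k) = P.toLinearMap x (P.coroot k) * (form P (P.root k) (P.root k) / 2) := by
  have h := form_reflection_reflection (P := P) k x (P.root k)
  rw [P.reflection_apply, P.reflection_apply_self, map_neg, map_sub, LinearMap.sub_apply, map_smul,
    LinearMap.smul_apply] at h
  have e : P.coroot' k x = P.toLinearMap x (P.coroot k) := rfl
  rw [e, smul_eq_mul] at h
  linarith

lemma form_root_ne_zero (k : ι) : form P (P.root k) (P.root k) ≠ 0 := by
  have : Nonempty ι := ⟨k⟩
  have := (form_shortest (P := P)).2 k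
  linarith

lemma dd_ne_zero (b : P.Base) (i : b.support) : dd b i ≠ 0 :=
  div_ne_zero (form_root_ne_zero _) two_ne_zero

lemma form_varpi_root [DecidableEq ι] [P.IsRootSystem] (b : P.Base) (i j : b.support) :
    form P (varpi b i) (P.root j) = if i = j then dd b i else 0 := by
  rw [form_root_right, coroot_varpi]
  split_ifs with h
  · rw [h, one_mul, dd]
  · rw [zero_mul]

lemma cartan_eq_toLinearMap (b : P.Base) (i j : b.support) :
    (cartan b i j : ℚ) = P.toLinearMap (P.root j) (P.coroot i) :=
  P.algebraMap_pairingIn ℤ (j : ι) i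

lemma cartan_mul_dd (b : P.Base) (i j : b.support) :
    (cartan b i j : ℚ) * dd b i = form P (P.root i) (P.root j) := by
  rw [form_comm, form_root_right, cartan_eq_toLinearMap, dd]

lemma cartan_eq_zero (b : P.Base) {i j : b.support} (hij : i ≠ j) (h : ¬ Adj b i j) :
    cartan b i j = 0 := by
  have h1 : cartan b i j ≤ 0 := b.cartanMatrix_le_zero_of_ne j i (Ne.symm hij)
  exact le_antisymm h1 (not_lt.mp fun h' => h ⟨hij, h'⟩)

lemma root_eq_sum_varpi [DecidableEq ι] [P.IsRootSystem] (b : P.Base) (j : b.support) :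
    P.root j = ∑ k, (cartan b k j : ℚ) • varpi b k := by
  apply P.toPerfPair.injective
  refine b.toCoweightBasis.ext fun m => ?_
  have h (x : M) : P.toPerfPair x (b.toCoweightBasis m) = P.toLinearMap x (P.coroot m) := by
    rw [b.toCoweightBasis_apply]; rfl
  rw [h, h, ← cartan_eq_toLinearMap]
  simp [LinearMap.sum_apply, coroot_varpi]

/-- Irreducibility enters through the possible ratios of squared root lengths, namely 1, 2, 3 and
their inverses. Comparison with a root of minimal squared length 2 leaves only 1, 2 and 3 as values.
-/
lemma exists_int_form_root_self [P.IsReduced] [P.IsIrreducible] (k : ι) :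
    ∃ n : ℤ, (n : ℚ) = form P (P.root k) (P.root k) / 2 := by
  have : Nonempty ι := ⟨k⟩
  obtain ⟨⟨k₀, h₀⟩, hle⟩ := form_shortest (P := P)
  let B : P.InvariantForm :=
    { form := form P
      symm := ⟨fun x y => by simpa using form_comm x y⟩
      ne_zero := form_root_ne_zero
      isOrthogonal_reflection := form_reflection_reflection }
  have h : form P (P.root k) (P.root k) = form P (P.root k₀) (P.root k₀) ∨
      form P (P.root k) (P.root k) = 2 * form P (P.root k₀) (P.root k₀) ∨
      form P (P.root k) (P.root k) = 3 * form P (P.root k₀) (P.root k₀) ∨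
      form P (P.root k₀) (P.root k₀) = 2 * form P (P.root k) (P.root k) ∨
      form P (P.root k₀) (P.root k₀) = 3 * form P (P.root k) (P.root k) := B.apply_eq_or k k₀
  have hk := hle k
  rw [h₀] at h
  rcases h with h | h | h | h | h
  · exact ⟨1, by rw [h]; norm_num⟩
  · exact ⟨2, by rw [h]; norm_num⟩
  · exact ⟨3, by rw [h]; norm_num⟩
  · linarith
  · linarith

lemma exists_int_form_root_root [P.IsReduced] [P.IsIrreducible] (k l : ι) :
    ∃ n : ℤ, (n : ℚ) = form P (P.root k) (P.root l) := by
  obtain ⟨n, hn⟩ := exists_int_form_root_self (P := P) l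
  refine ⟨P.pairingIn ℤ k l * n, ?_⟩
  rw [form_root_right, ← hn, Int.cast_mul]
  congr 1
  exact P.algebraMap_pairingIn ℤ k l

end FormFacts

/-! ### The mesh relations for Coxeter orbits of weights and roots. -/

section Mesh

variable {ι M N : Type*} [Fintype ι] [DecidableEq ι] [AddCommGroup M] [Module ℚ M]
  [AddCommGroup N] [Module ℚ N] {P : RootPairing ι ℚ M N}
  [P.IsRootSystem] [P.IsCrystallographic] [P.IsReduced] {b : P.Base}

/-- In a word adapted to `ξ`, without repetitions, the letters are ordered by decreasing height
along edges. -/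
lemma IsAdapted.lt_of_adj {ξ : b.support → ℤ} {s t : List b.support} {j : b.support}
    (hn : (s ++ j :: t).Nodup) (ha : IsAdapted b ξ (s ++ j :: t)) {k : b.support}
    (hk : k ∈ s) (hkj : Adj b k j) : ξ j < ξ k := by
  induction s generalizing ξ with
  | nil => simp at hk
  | cons a s ih =>
    rw [List.cons_append, List.nodup_cons] at hn
    obtain ⟨h1, h2⟩ := ha
    by_cases hka : k = a
    · subst hka
      exact h1 j hkj
    · have h3 := ih hn.2 h2 ((List.mem_cons.mp hk).resolve_left hka)
      have hja : a ≠ j := by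
        rintro rfl
        exact hn.1 (by simp)
      simpa [reflHeight, Ne.symm hka, hja] using h3

/-- In a word adapted to `ξ`, without repetitions, the letters are ordered by decreasing height
along edges. -/
lemma IsAdapted.lt_of_adj' {ξ : b.support → ℤ} {s t : List b.support} {j : b.support}
    (hn : (s ++ j :: t).Nodup) (ha : IsAdapted b ξ (s ++ j :: t)) {k : b.support}
    (hk : k ∈ t) (hkj : Adj b k j) : ξ k < ξ j := by
  obtain ⟨u, v, rfl⟩ := List.append_of_mem hk
  have e : s ++ j :: (u ++ k :: v) = (s ++ j :: u) ++ k :: v := by simp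
  rw [e] at hn ha
  exact ha.lt_of_adj hn (by simp) (adj_symm hkj)

/-- Split an adapted word at j as s, j, t. Then τ ϖ_j = ϖ_j - s α_j with α_j = ∑ c_kj ϖ_k, and s
acts on ϖ_k as τ if k lies in s and trivially if k lies in t. For a neighbour k these cases mean ξ_k
= ξ_j + 1 and ξ_k = ξ_j - 1, and the exponent (ξ_k - ξ_j + 1)/2 is 1 or 0 accordingly.
Non-neighbours have coefficient 0. -/
lemma coxeter_smul_varpi_add (Q : DynkinQuiver b) (j : b.support) :
    coxeter Q • varpi b j + varpi b j + ∑ k ∈ Finset.univ.erase j,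
      (cartan b k j : ℚ) • ((coxeter Q ^ ((Q.ξ k - Q.ξ j + 1) / 2)) • varpi b k) = 0 := by
  obtain ⟨l, hn, hm, ha, hτ⟩ := coxeter_spec Q
  obtain ⟨s, t, rfl⟩ := List.append_of_mem (hm j)
  have hs : j ∉ s := fun h => (List.nodup_append.mp hn).2.2 j h j (by simp) rfl
  have ht : j ∉ t := (List.nodup_cons.mp (List.nodup_append.mp hn).2.1).1
  have h1 : coxeter Q • varpi b j = varpi b j - wordProd b s • P.root j := by
    rw [← hτ, wordProd_append, wordProd_cons, mul_smul, mul_smul, wordProd_varpi t j ht,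
      srefl_varpi_self, smul_sub, wordProd_varpi s j hs]
  have h2 : wordProd b s • P.root j = (2 : ℚ) • varpi b j + ∑ k ∈ Finset.univ.erase j,
      (cartan b k j : ℚ) • (wordProd b s • varpi b k) := by
    rw [root_eq_sum_varpi, Finset.smul_sum, ← Finset.add_sum_erase _ _ (Finset.mem_univ j),
      weyl_smul_smul, wordProd_varpi s j hs]
    congr 1
    · simp [cartan]
    · exact Finset.sum_congr rfl fun k _ => weyl_smul_smul _ _ _
  have h3 : ∀ k ∈ Finset.univ.erase j, (cartan b k j : ℚ) • (wordProd b s • varpi b k) =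
      (cartan b k j : ℚ) • ((coxeter Q ^ ((Q.ξ k - Q.ξ j + 1) / 2)) • varpi b k) := by
    intro k hk
    have hkj : k ≠ j := Finset.ne_of_mem_erase hk
    by_cases hadj : Adj b k j
    · congr 1
      have habs := Q.abs_sub_eq_one k j hadj
      by_cases hks : k ∈ s
      · have hlt := ha.lt_of_adj hn hks hadj
        rw [abs_of_pos (by lia)] at habs
        rw [habs]
        have hkt : k ∉ t := fun h => (List.nodup_append.mp hn).2.2 k hks k (by simp [h]) rfl
        norm_num
        rw [← hτ, wordProd_append, wordProd_cons, mul_smul, mul_smul, wordProd_varpi t k hkt,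
          srefl_varpi_of_ne hkj]
      · have hkt : k ∈ t := by
          have := hm k
          simp [hks, hkj] at this
          exact this
        have hlt := ha.lt_of_adj' hn hkt hadj
        rw [abs_of_neg (by lia)] at habs
        rw [show Q.ξ k - Q.ξ j + 1 = 0 by lia, wordProd_varpi s k hks]
        simp
    · rw [cartan_eq_zero b hkj hadj]
      simp
  rw [h1, h2, Finset.sum_congr rfl h3]
  module

/-- The weights `τ_Q ^ ((ξ_j - p) / 2) ϖ_j`, extended by `0` to the pairs `(j, p)` of the wrong
parity. -/
def slideWeight (Q : DynkinQuiver b) (j : b.support) (p : ℤ) : M :=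
  if Even (Q.ξ j - p) then coxeter Q ^ ((Q.ξ j - p) / 2) • varpi b j else 0

/-- The roots `τ_Q ^ ((ξ_j - p) / 2) γ_j`, extended by `0` to the pairs `(j, p)` of the wrong
parity. -/
def slideRoot (Q : DynkinQuiver b) (j : b.support) (p : ℤ) : M :=
  slideWeight Q j p - slideWeight Q j (p - 2)

lemma coxeter_zpow_smul_slideWeight (Q : DynkinQuiver b) (j : b.support) (p m : ℤ) :
    coxeter Q ^ m • slideWeight Q j p = slideWeight Q j (p - 2 * m) := by
  have e : Even (Q.ξ j - (p - 2 * m)) ↔ Even (Q.ξ j - p) := by grind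
  unfold slideWeight
  simp only [e]
  split_ifs with h
  · rw [← mul_smul, ← zpow_add]
    congr 2
    lia
  · exact smul_zero _

lemma coxeter_zpow_smul_slideRoot (Q : DynkinQuiver b) (j : b.support) (p m : ℤ) :
    coxeter Q ^ m • slideRoot Q j p = slideRoot Q j (p - 2 * m) := by
  rw [slideRoot, slideRoot, smul_sub, coxeter_zpow_smul_slideWeight,
    coxeter_zpow_smul_slideWeight]
  congr 2
  lia

lemma slideWeight_height (Q : DynkinQuiver b) (j : b.support) :
    slideWeight Q j (Q.ξ j) = varpi b j := by
  simp [slideWeight]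

lemma slideWeight_eq_zero (Q : DynkinQuiver b) {j : b.support} {p : ℤ} (h : ¬ Even (Q.ξ j - p)) :
    slideWeight Q j p = 0 := if_neg h

lemma slideRoot_eq_zero (Q : DynkinQuiver b) {j : b.support} {p : ℤ} (h : ¬ Even (Q.ξ j - p)) :
    slideRoot Q j p = 0 := by
  rw [slideRoot, slideWeight_eq_zero Q h, slideWeight_eq_zero Q (by grind), sub_zero]

lemma slideRoot_eq (Q : DynkinQuiver b) {j : b.support} {p : ℤ} (h : Even (Q.ξ j - p)) :
    slideRoot Q j p = coxeter Q ^ ((Q.ξ j - p) / 2) • P.root (gamma Q j) := by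
  have h' : Even (Q.ξ j - (p - 2)) := by grind
  rw [slideRoot, slideWeight, slideWeight, if_pos h, if_pos h', root_gamma, smul_sub, ← mul_smul,
    ← zpow_add_one]
  congr 3
  lia

lemma even_sub_of_adj (Q : DynkinQuiver b) {k j : b.support} (h : Adj b k j) (p : ℤ) :
    Even (Q.ξ k - p) ↔ ¬ Even (Q.ξ j - p) := by
  have := Q.abs_sub_eq_one k j h
  rcases (abs_eq zero_le_one).mp this with h | h <;> grind

lemma slideWeight_mesh (Q : DynkinQuiver b) (j : b.support) (p : ℤ) :
    slideWeight Q j (p + 1) + slideWeight Q j (p - 1) + ∑ k ∈ Finset.univ.erase j,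
      (cartan b k j : ℚ) • slideWeight Q k p = 0 := by
  by_cases hp : Even (Q.ξ j - p)
  · rw [slideWeight_eq_zero Q (by grind), slideWeight_eq_zero Q (by grind), add_zero, zero_add]
    refine Finset.sum_eq_zero fun k hk => ?_
    by_cases hadj : Adj b k j
    · rw [slideWeight_eq_zero Q (by rw [even_sub_of_adj Q hadj]; simpa), smul_zero]
    · rw [cartan_eq_zero b (Finset.ne_of_mem_erase hk) hadj, Int.cast_zero, zero_smul]
  -- Otherwise the relation is the τ^m-translate of the one at p = ξ_j - 1, which is
  -- `coxeter_smul_varpi_add`.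
  · obtain ⟨m, hm⟩ : ∃ m, p = Q.ξ j - 1 - 2 * m := by
      rw [Int.not_even_iff_odd] at hp
      obtain ⟨m, hm⟩ := hp
      exact ⟨m, by lia⟩
    have key := congrArg (fun x => coxeter Q ^ m • x) (coxeter_smul_varpi_add Q j)
    simp only [smul_add, smul_zero, Finset.smul_sum, weyl_smul_smul] at key
    rw [← key]
    have e1 : p + 1 = Q.ξ j - 2 * m := by lia
    have e2 : p - 1 = Q.ξ j - 2 * 1 - 2 * m := by lia
    rw [e1, e2, ← coxeter_zpow_smul_slideWeight, ← coxeter_zpow_smul_slideWeight,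
      ← coxeter_zpow_smul_slideWeight, slideWeight_height, zpow_one,
      add_comm (coxeter Q ^ m • varpi b j)]
    congr 1
    refine Finset.sum_congr rfl fun k hk => ?_
    by_cases hadj : Adj b k j
    · congr 1
      rw [hm, ← coxeter_zpow_smul_slideWeight, slideWeight, if_pos, show
        Q.ξ k - (Q.ξ j - 1) = Q.ξ k - Q.ξ j + 1 by ring]
      rw [even_sub_of_adj Q hadj]
      simp
    · rw [cartan_eq_zero b (Finset.ne_of_mem_erase hk) hadj, Int.cast_zero, zero_smul, zero_smul]

lemma slideRoot_mesh (Q : DynkinQuiver b) (j : b.support) (p : ℤ) :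
    slideRoot Q j (p + 1) + slideRoot Q j (p - 1) + ∑ k ∈ Finset.univ.erase j,
      (cartan b k j : ℚ) • slideRoot Q k p = 0 := by
  have h1 := slideWeight_mesh Q j p
  have h2 := slideWeight_mesh Q j (p - 2)
  simp only [slideRoot, smul_sub, Finset.sum_sub_distrib]
  rw [show p - 2 + 1 = p + 1 - 2 by ring, show p - 2 - 1 = p - 1 - 2 by ring] at h2
  rw [← sub_zero (0 : M)]
  nth_rewrite 1 [← h1]
  rw [← h2]
  abel

end Mesh

/-! ### Laurent coefficients of a matrix inverse. -/

section Coefficients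

variable {F n : Type*} [Field F] [Fintype n] [DecidableEq n]

/-- The recursion for the Laurent coefficients of a matrix `A` over `F(t)` which satisfies
`A * C = diag d`, where `C` has diagonal entries `t + t⁻¹` and off-diagonal entries `c i j`. -/
lemma coeff_mesh (A : Matrix n n (RatFunc F)) (c : n → n → ℤ) (d : n → F)
    (h : A * (.of fun i j => if i = j then RatFunc.X + RatFunc.X⁻¹ else (c i j : RatFunc F)) =
      Matrix.diagonal fun i => RatFunc.C (d i)) (i j : n) (u : ℤ) :
    ((A i j : RatFunc F) : LaurentSeries F).coeff (u + 1) +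
      ((A i j : RatFunc F) : LaurentSeries F).coeff (u - 1) + ∑ k ∈ Finset.univ.erase j,
      (c k j : F) * ((A i k : RatFunc F) : LaurentSeries F).coeff u =
        if i = j ∧ u = 0 then d i else 0 := by
  have h1 := congrFun (congrFun h i) j
  rw [Matrix.mul_apply, ← Finset.add_sum_erase _ _ (Finset.mem_univ j)] at h1
  have h2 := congrArg (fun f : RatFunc F => (f : LaurentSeries F).coeff u) h1
  have hC (a : F) : ((RatFunc.C a : RatFunc F) : LaurentSeries F) = HahnSeries.C a := by
    rw [← RatFunc.algebraMap_C, ← IsScalarTower.algebraMap_apply]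
    simp
  have hZ (a : ℤ) : ((a : RatFunc F) : LaurentSeries F) = HahnSeries.C (a : F) := by
    rw [← hC, map_intCast, map_intCast, map_intCast]
  -- Multiplication by t + t⁻¹ shifts the coefficients by one in both directions.
  have hl : (((A i j * (RatFunc.X + RatFunc.X⁻¹) : RatFunc F)) : LaurentSeries F).coeff u =
      ((A i j : RatFunc F) : LaurentSeries F).coeff (u + 1) +
      ((A i j : RatFunc F) : LaurentSeries F).coeff (u - 1) := by
    rw [mul_comm, map_mul, map_add, map_inv₀, RatFunc.coe_X, HahnSeries.inv_single, add_mul,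
      HahnSeries.coeff_add, HahnSeries.coeff_single_mul, HahnSeries.coeff_single_mul, add_comm]
    simp
  have hr : ((Matrix.diagonal (fun i => RatFunc.C (d i)) i j : RatFunc F) :
      LaurentSeries F).coeff u = if i = j ∧ u = 0 then d i else 0 := by
    by_cases hij : i = j
    · simp [hij, hC, HahnSeries.C_apply, HahnSeries.coeff_single]
    · simp [hij]
  have hs : ((∑ k ∈ Finset.univ.erase j, A i k *
      Matrix.of (fun i j => if i = j then RatFunc.X + RatFunc.X⁻¹ else (c i j : RatFunc F)) k j :
        RatFunc F) : LaurentSeries F).coeff u =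
      ∑ k ∈ Finset.univ.erase j, (c k j : F) * ((A i k : RatFunc F) : LaurentSeries F).coeff u := by
    rw [map_sum, HahnSeries.coeff_sum]
    refine Finset.sum_congr rfl fun k hk => ?_
    rw [Matrix.of_apply, if_neg (Finset.ne_of_mem_erase hk), mul_comm, map_mul, hZ,
      HahnSeries.C_mul_eq_smul, HahnSeries.coeff_smul, smul_eq_mul]
  rw [← hl, ← hr, ← h2, ← hs, Matrix.of_apply, if_pos rfl]
  simp only [map_add, HahnSeries.coeff_add]

end Coefficients

/-! ### The inverse of B(t): symmetry, recursion and initial values. -/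

section Laurent

variable {ι M N : Type*} [Fintype ι] [DecidableEq ι] [AddCommGroup M] [Module ℚ M]
  [AddCommGroup N] [Module ℚ N] {P : RootPairing ι ℚ M N} [P.IsCrystallographic]

open Polynomial in
-- The matrix t C(t) has polynomial entries and specializes to the identity at t = 0, so its
-- determinant is a nonzero polynomial.
lemma isUnit_det_cartanT (b : P.Base) : IsUnit (cartanT b).det := by
  let A : Matrix b.support b.support ℚ[X] := .of fun i j =>
    if i = j then X ^ 2 + 1 else X * (cartan b i j : ℚ[X])
  have hA : A.map (algebraMap ℚ[X] (RatFunc ℚ)) = (RatFunc.X : RatFunc ℚ) • cartanT b := by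
    ext i j
    by_cases h : i = j
    · have := RatFunc.X_ne_zero (K := ℚ)
      simp [A, cartanT, h]
      field_simp
    · simp [A, cartanT, h]
  have h0 : A.map (evalRingHom 0) = 1 := by
    ext i j
    by_cases h : i = j <;> simp [A, Matrix.one_apply, h]
  have h1 : A.det ≠ 0 := by
    intro h
    have := congrArg (evalRingHom 0) h
    rw [RingHom.map_det, RingHom.mapMatrix_apply, h0] at this
    simp at this
  have h2 : ((RatFunc.X : RatFunc ℚ) • cartanT b).det ≠ 0 := by
    rw [← hA, ← RingHom.mapMatrix_apply, ← RingHom.map_det]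
    simpa using h1
  rw [Matrix.det_smul] at h2
  exact isUnit_iff_ne_zero.mpr (right_ne_zero_of_mul h2)

lemma isUnit_det_BT (b : P.Base) : IsUnit (BT b).det := by
  rw [BT, Matrix.det_mul]
  refine (isUnit_det_cartanT b).mul ?_
  rw [Matrix.det_diagonal, isUnit_iff_ne_zero, Finset.prod_ne_zero_iff]
  intro i _
  simpa using dd_ne_zero b i

lemma BT_inv_mul_cartanT (b : P.Base) :
    (BT b)⁻¹ * cartanT b = Matrix.diagonal fun i => RatFunc.C (dd b i) := by
  have h : cartanT b = BT b * Matrix.diagonal fun i => RatFunc.C (dd b i) := by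
    rw [BT, Matrix.mul_assoc, Matrix.diagonal_mul_diagonal]
    have e : (fun i => RatFunc.C (dd b i)⁻¹ * RatFunc.C (dd b i)) =
        fun _ : b.support => (1 : RatFunc ℚ) := by
      funext i
      rw [← map_mul, inv_mul_cancel₀ (dd_ne_zero b i), map_one]
    rw [e, Matrix.diagonal_one, Matrix.mul_one]
  rw [h, ← Matrix.mul_assoc, Matrix.nonsing_inv_mul _ (isUnit_det_BT b), Matrix.one_mul]

/-- Off the diagonal the entry is (α_i, α_j)/(d_i d_j). -/
lemma BT_transpose (b : P.Base) : (BT b).transpose = BT b := by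
  ext i j
  rw [Matrix.transpose_apply, BT, Matrix.mul_diagonal, Matrix.mul_diagonal]
  by_cases h : i = j
  · rw [h]
  · simp only [cartanT, Matrix.of_apply, h, Ne.symm h, if_false]
    have e (k l : b.support) : (cartan b k l : RatFunc ℚ) * RatFunc.C (dd b l)⁻¹ =
        RatFunc.C (form P (P.root k) (P.root l) / (dd b k * dd b l)) := by
      rw [← cartan_mul_dd, ← map_intCast (RatFunc.C (K := ℚ)), ← map_mul]
      congr 1
      have := dd_ne_zero b k
      have := dd_ne_zero b l
      field_simp
    rw [e, e, form_comm, mul_comm (dd b j)]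

lemma btilde_comm (b : P.Base) (i j : b.support) (u : ℤ) : btilde b i j u = btilde b j i u := by
  have h : (BT b)⁻¹ i j = (BT b)⁻¹ j i := by
    nth_rewrite 1 [← BT_transpose]
    rw [← Matrix.transpose_nonsing_inv, Matrix.transpose_apply]
  rw [btilde, btilde, h]

lemma btilde_mesh (b : P.Base) (i j : b.support) (u : ℤ) :
    btilde b i j (u + 1) + btilde b i j (u - 1) + ∑ k ∈ Finset.univ.erase j,
      (cartan b k j : ℚ) * btilde b i k u = if i = j ∧ u = 0 then dd b i else 0 :=
  coeff_mesh (BT b)⁻¹ (cartan b) (dd b) (BT_inv_mul_cartanT b) i j u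

/-- Finitely many Laurent series have a common lower bound m for their orders. From there the
recursion propagates zeros upwards, since its source at u = 0 first affects the coefficient of t. -/
lemma btilde_eq_zero (b : P.Base) (i j : b.support) {u : ℤ} (hu : u ≤ 0) : btilde b i j u = 0 := by
  obtain ⟨m, hm⟩ : ∃ m : ℤ, ∀ i j : b.support, ∀ u < m, btilde b i j u = 0 := by
    let f (x : b.support × b.support) : LaurentSeries ℚ := ((BT b)⁻¹ x.1 x.2 : RatFunc ℚ)
    obtain ⟨m, hm⟩ := (Set.finite_range fun x => (f x).order).bddBelow
    refine ⟨m, fun i j u hu => ?_⟩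
    exact HahnSeries.coeff_eq_zero_of_lt_order (x := f (i, j))
      (hu.trans_le (hm ⟨(i, j), rfl⟩))
  have key : ∀ n : ℕ, ∀ i j : b.support, ∀ u ≤ 0, u < m + n → btilde b i j u = 0 := by
    intro n
    induction n with
    | zero => exact fun i j u _ hu => hm i j u (by simpa using hu)
    | succ n ih =>
      intro i j u hu0 hu
      have h := btilde_mesh b i j (u - 1)
      rw [if_neg (by lia), sub_add_cancel, ih i j (u - 1 - 1) (by lia) (by push_cast at hu; lia),
        Finset.sum_eq_zero, add_zero, add_zero] at h
      · exact h
      · intro k _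
        rw [ih i k _ (by lia) (by push_cast at hu; lia), mul_zero]
  exact key (u - m + 1).toNat i j u hu (by lia)

lemma btilde_one (b : P.Base) (i j : b.support) :
    btilde b i j 1 = if i = j then dd b i else 0 := by
  have h := btilde_mesh b i j 0
  rw [zero_add, btilde_eq_zero b i j (by lia : (0 : ℤ) - 1 ≤ 0), Finset.sum_eq_zero] at h
  · simpa using h
  · intro k _
    rw [btilde_eq_zero b i k le_rfl, mul_zero]

lemma NN_antisymm (b : P.Base) (i j : b.support) (p s : ℤ) : NN b i p j s = -NN b j s i p := by
  simp only [NN, etaT, btilde_comm b i j]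
  rw [show s - p - 1 = -(p - s + 1) by ring, show s - p + 1 = -(p - s - 1) by ring, neg_neg,
    neg_neg]
  ring

lemma NN_self (b : P.Base) (i j : b.support) (p : ℤ) : NN b i p j p = 0 := by
  simp [NN, etaT, add_comm]

/-- Since p - s - 1 and p - s + 1 are both nonnegative, the reflected terms of η̃ vanish. -/
lemma NN_of_lt (b : P.Base) (i j : b.support) {p s : ℤ} (h : s < p) :
    NN b i p j s = btilde b i j (p - s - 1) - btilde b i j (p - s + 1) := by
  rw [NN, etaT, etaT, btilde_eq_zero b i j (by lia : -(p - s - 1) ≤ 0),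
    btilde_eq_zero b i j (by lia : -(p - s + 1) ≤ 0), add_zero, add_zero]

end Laurent

/-! ### Pairings with fundamental weights and the Laurent coefficients. -/

section Values

variable {ι M N : Type*} [Fintype ι] [DecidableEq ι] [AddCommGroup M] [Module ℚ M]
  [AddCommGroup N] [Module ℚ N] {P : RootPairing ι ℚ M N}
  [P.IsRootSystem] [P.IsCrystallographic] [P.IsReduced] {b : P.Base}

lemma form_varpi_wordProd_smul (l : List b.support) (i : b.support) (h : i ∉ l) (x : M) :
    form P (varpi b i) (wordProd b l • x) = form P (varpi b i) x := by
  induction l with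
  | nil => simp [wordProd]
  | cons a t ih =>
    rw [List.mem_cons, not_or] at h
    rw [wordProd_cons, mul_smul, ← ih h.2, ← form_smul_smul (srefl b a)⁻¹, inv_smul_smul,
      inv_smul_eq_iff.mpr (srefl_varpi_of_ne h.1).symm]

lemma form_varpi_wordProd_inv_smul (l : List b.support) (i : b.support) (h : i ∉ l) (x : M) :
    form P (varpi b i) ((wordProd b l)⁻¹ • x) = form P (varpi b i) x := by
  rw [← form_varpi_wordProd_smul l i h, smul_inv_smul]

/-- An adapted expression of the Coxeter element can be obtained by sorting the vertices with
respect to any function which refines the height function. -/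
lemma exists_wordProd_eq_coxeter (Q : DynkinQuiver b) (f : b.support → ℤ)
    (hf : ∀ i j, f j ≤ f i → Q.ξ j ≤ Q.ξ i) :
    ∃ l : List b.support, l.Nodup ∧ (∀ i, i ∈ l) ∧ (l.Pairwise fun i j => f j ≤ f i) ∧
      wordProd b l = coxeter Q := by
  let l : List b.support := (Finset.univ : Finset b.support).toList.mergeSort
    (fun i j => decide (f j ≤ f i))
  have hp : l.Perm (Finset.univ : Finset b.support).toList := List.mergeSort_perm _ _
  have hmem : ∀ i, i ∈ l := fun i => hp.mem_iff.mpr (by simp)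
  have hn : l.Nodup := hp.nodup_iff.mpr (Finset.nodup_toList _)
  have hs : l.Pairwise fun i j => f j ≤ f i := by
    have := List.pairwise_mergeSort (le := fun i j : b.support => decide (f j ≤ f i))
      (by intro a c d; simp; lia) (by intro a c; simp; lia)
      (Finset.univ : Finset b.support).toList
    exact this.imp fun h => by simpa using h
  refine ⟨l, hn, hmem, hs, ?_⟩
  refine (existsUnique_isAdaptedCoxeter Q).unique ⟨l, hn, hmem, ?_, rfl⟩ (coxeter_spec Q)
  refine exists_isAdapted_aux _ _ hn (hs.imp fun h => hf _ _ h) ?_ ?_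
  · exact fun i _ j _ h => Q.abs_sub_eq_one i j h
  · exact fun i _ j hj => absurd (hmem j) hj

lemma form_varpi_slideRoot_self (Q : DynkinQuiver b) (i : b.support) :
    form P (varpi b i) (slideRoot Q i (Q.ξ i)) = dd b i := by
  obtain ⟨l, hn, hm, -, hl⟩ := exists_wordProd_eq_coxeter Q Q.ξ fun _ _ h => h
  obtain ⟨s, t, rfl⟩ := List.append_of_mem (hm i)
  have hs : i ∉ s := fun h => (List.nodup_append.mp hn).2.2 i h i (by simp) rfl
  have ht : i ∉ t := (List.nodup_cons.mp (List.nodup_append.mp hn).2.1).1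
  have e : varpi b i - coxeter Q • varpi b i = wordProd b s • P.root i := by
    rw [← hl, wordProd_append, wordProd_cons, mul_smul, mul_smul, wordProd_varpi t i ht,
      srefl_varpi_self, smul_sub, wordProd_varpi s i hs]
    abel
  rw [slideRoot_eq Q (by simp), root_gamma, sub_self, Int.zero_ediv, zpow_zero, one_smul, e,
    form_varpi_wordProd_smul s i hs, form_varpi_root, if_pos rfl]

/-- An adapted word can list j before all other vertices of its height. Then γ_j = s α_j for a
prefix s that avoids i, so s does not change the pairing with ϖ_i. -/
lemma form_varpi_slideRoot_height (Q : DynkinQuiver b) {i j : b.support} (hij : i ≠ j)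
    (h : Q.ξ i ≤ Q.ξ j) : form P (varpi b i) (slideRoot Q j (Q.ξ j)) = 0 := by
  obtain ⟨l, hn, hm, hp, hl⟩ := exists_wordProd_eq_coxeter Q
    -- Doubling the height leaves room for the tie-break in favour of j.
    (fun k => 2 * Q.ξ k + if k = j then 1 else 0) (by intro k m hkm; split_ifs at hkm <;> lia)
  obtain ⟨s, t, rfl⟩ := List.append_of_mem (hm j)
  have hs : j ∉ s := fun h => (List.nodup_append.mp hn).2.2 j h j (by simp) rfl
  have ht : j ∉ t := (List.nodup_cons.mp (List.nodup_append.mp hn).2.1).1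
  have his : i ∉ s := by
    intro his
    have := (List.pairwise_append.mp hp).2.2 i his j (by simp)
    simp only [if_true, if_neg hij] at this
    lia
  have e : varpi b j - coxeter Q • varpi b j = wordProd b s • P.root j := by
    rw [← hl, wordProd_append, wordProd_cons, mul_smul, mul_smul, wordProd_varpi t j ht,
      srefl_varpi_self, smul_sub, wordProd_varpi s j hs]
    abel
  rw [slideRoot_eq Q (by simp), root_gamma, sub_self, Int.zero_ediv, zpow_zero, one_smul, e,
    form_varpi_wordProd_smul s i his, form_varpi_root, if_neg hij]

/-- Dual to the previous case: j is listed last among the vertices of its height, and τ⁻¹ ϖ_j - ϖ_j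
= -t⁻¹ α_j for a suffix t that avoids i. -/
lemma form_varpi_slideRoot_height_add_two (Q : DynkinQuiver b) {i j : b.support} (hij : i ≠ j)
    (h : Q.ξ j ≤ Q.ξ i) : form P (varpi b i) (slideRoot Q j (Q.ξ j + 2)) = 0 := by
  obtain ⟨l, hn, hm, hp, hl⟩ := exists_wordProd_eq_coxeter Q
    (fun k => 2 * Q.ξ k - if k = j then 1 else 0) (by intro k m hkm; split_ifs at hkm <;> lia)
  obtain ⟨s, t, rfl⟩ := List.append_of_mem (hm j)
  have hs : j ∉ s := fun h => (List.nodup_append.mp hn).2.2 j h j (by simp) rfl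
  have ht : j ∉ t := (List.nodup_cons.mp (List.nodup_append.mp hn).2.1).1
  have hit : i ∉ t := by
    intro hit
    have := (List.pairwise_cons.mp (List.pairwise_append.mp hp).2.1).1 i hit
    simp only [if_true, if_neg hij] at this
    lia
  have e : coxeter Q • (varpi b j - (wordProd b t)⁻¹ • P.root j) = varpi b j := by
    rw [← hl, wordProd_append, wordProd_cons, mul_smul, mul_smul, smul_sub, smul_inv_smul,
      wordProd_varpi t j ht, ← srefl_varpi_self, ← mul_smul (srefl b j)]
    have : srefl b j * srefl b j = 1 := by
      refine Subtype.ext (RootPairing.Equiv.weightHom_injective P ?_)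
      ext x
      exact P.reflection_same j x
    rw [this, one_smul, wordProd_varpi s j hs]
  have e2 : slideRoot Q j (Q.ξ j + 2) = -((wordProd b t)⁻¹ • P.root j) := by
    have e3 : slideRoot Q j (Q.ξ j + 2) = (coxeter Q)⁻¹ • varpi b j - varpi b j := by
      rw [slideRoot, add_sub_cancel_right, slideWeight_height, ← slideWeight_height,
        ← zpow_neg_one, coxeter_zpow_smul_slideWeight]
      simp
    rw [e3, inv_smul_eq_iff.mpr e.symm]
    abel
  rw [e2, map_neg, form_varpi_wordProd_inv_smul t i hit, form_varpi_root, if_neg hij, neg_zero]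

lemma form_varpi_slideRoot_mesh (Q : DynkinQuiver b) (i j : b.support) (p : ℤ) :
    form P (varpi b i) (slideRoot Q j (p + 1)) + form P (varpi b i) (slideRoot Q j (p - 1)) +
      ∑ k ∈ Finset.univ.erase j,
        (cartan b k j : ℚ) * form P (varpi b i) (slideRoot Q k p) = 0 := by
  have h := congrArg (form P (varpi b i)) (slideRoot_mesh Q j p)
  simpa [map_sum] using h

/-- Downward induction on s through the mesh relation at s + 1, starting from s = ξ_j. When s + 2 ≤
ξ_j, a neighbour k of j has ξ_k ≥ s + 1 > ξ_i, so k ≠ i and the induction hypothesis applies to it.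
-/
lemma form_varpi_slideRoot_of_le_height (Q : DynkinQuiver b) {i j : b.support} (hij : i ≠ j)
    {s : ℤ} (h₁ : Q.ξ i ≤ s) (h₂ : s ≤ Q.ξ j) :
    form P (varpi b i) (slideRoot Q j s) = 0 := by
  obtain ⟨B, hB⟩ := (Set.finite_range Q.ξ).bddAbove
  have hB (k) : Q.ξ k ≤ B := hB ⟨k, rfl⟩
  -- The number n bounds the distance from s to the maximal height, uniformly in j.
  have key : ∀ n : ℕ, ∀ j s, i ≠ j → Q.ξ i ≤ s → s ≤ Q.ξ j → B < s + n →
      form P (varpi b i) (slideRoot Q j s) = 0 := by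
    intro n
    induction n using Nat.strong_induction_on with
    | _ n ih =>
    intro j s hij h₁ h₂ hn
    have := hB j
    by_cases hpar : Even (Q.ξ j - s)
    · rcases h₂.eq_or_lt with rfl | hlt
      · exact form_varpi_slideRoot_height Q hij h₁
      · have h2 : s + 2 ≤ Q.ξ j := by
          obtain ⟨m, hm⟩ := hpar
          lia
        have hmesh := form_varpi_slideRoot_mesh Q i j (s + 1)
        rw [add_assoc s, add_sub_cancel_right, show (1 : ℤ) + 1 = 2 by rfl,
          ih (n - 2) (by lia) j (s + 2) hij (by lia) h2 (by lia), Finset.sum_eq_zero, zero_add,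
          add_zero] at hmesh
        · exact hmesh
        · intro k hk
          by_cases hadj : Adj b k j
          · have hd := (abs_le.mp (Q.abs_sub_eq_one k j hadj).le).1
            have hik : i ≠ k := by
              rintro rfl
              lia
            rw [ih (n - 1) (by lia) k (s + 1) hik (by lia) (by lia) (by lia), mul_zero]
          · rw [cartan_eq_zero b (Finset.ne_of_mem_erase hk) hadj, Int.cast_zero, zero_mul]
    · rw [slideRoot_eq_zero Q hpar, map_zero]
  exact key (B + 1 - s).toNat j s hij h₁ h₂ (by lia)

/-- The mirror image: upward induction on s, starting from s = ξ_j + 2. -/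
lemma form_varpi_slideRoot_of_height_lt (Q : DynkinQuiver b) {i j : b.support} (hij : i ≠ j)
    {s : ℤ} (h₁ : Q.ξ j + 2 ≤ s) (h₂ : s ≤ Q.ξ i + 1) :
    form P (varpi b i) (slideRoot Q j s) = 0 := by
  obtain ⟨B, hB⟩ := (Set.finite_range Q.ξ).bddBelow
  have hB (k) : B ≤ Q.ξ k := hB ⟨k, rfl⟩
  have key : ∀ n : ℕ, ∀ j s, i ≠ j → Q.ξ j + 2 ≤ s → s ≤ Q.ξ i + 1 → s < B + n →
      form P (varpi b i) (slideRoot Q j s) = 0 := by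
    intro n
    induction n using Nat.strong_induction_on with
    | _ n ih =>
    intro j s hij h₁ h₂ hn
    have := hB j
    by_cases hpar : Even (Q.ξ j - s)
    · rcases h₁.eq_or_lt with rfl | hlt
      · exact form_varpi_slideRoot_height_add_two Q hij (by lia)
      · have h2 : Q.ξ j + 2 ≤ s - 2 := by
          obtain ⟨m, hm⟩ := hpar
          lia
        have hmesh := form_varpi_slideRoot_mesh Q i j (s - 1)
        rw [sub_add_cancel, sub_sub, show (1 : ℤ) + 1 = 2 by rfl,
          ih (n - 2) (by lia) j (s - 2) hij (by lia) (by lia) (by lia), Finset.sum_eq_zero,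
          add_zero, add_zero] at hmesh
        · exact hmesh
        · intro k hk
          by_cases hadj : Adj b k j
          · have hd := (abs_le.mp (Q.abs_sub_eq_one k j hadj).le).2
            have hik : i ≠ k := by
              rintro rfl
              lia
            rw [ih (n - 1) (by lia) k (s - 1) hik (by lia) (by lia) (by lia), mul_zero]
          · rw [cartan_eq_zero b (Finset.ne_of_mem_erase hk) hadj, Int.cast_zero, zero_mul]
    · rw [slideRoot_eq_zero Q hpar, map_zero]
  exact key (s + 1 - B).toNat j s hij h₁ h₂ (by have := hB j; lia)

lemma form_varpi_slideRoot_eq_zero (Q : DynkinQuiver b) {i j : b.support} (hij : i ≠ j)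
    {s : ℤ} (h₁ : Q.ξ i ≤ s) (h₂ : s ≤ Q.ξ i + 1) :
    form P (varpi b i) (slideRoot Q j s) = 0 := by
  rcases le_or_gt s (Q.ξ j) with h | h
  · exact form_varpi_slideRoot_of_le_height Q hij h₁ h
  -- The gap s = ξ_j + 1 between the two ranges has the wrong parity.
  · by_cases hpar : Even (Q.ξ j - s)
    · refine form_varpi_slideRoot_of_height_lt Q hij ?_ h₂
      obtain ⟨m, hm⟩ := hpar
      lia
    · rw [slideRoot_eq_zero Q hpar, map_zero]

lemma form_varpi_slideRoot_height_left (Q : DynkinQuiver b) (i j : b.support) :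
    form P (varpi b i) (slideRoot Q j (Q.ξ i)) = if i = j then dd b i else 0 := by
  split_ifs with h
  · rw [← h, form_varpi_slideRoot_self]
  · exact form_varpi_slideRoot_eq_zero Q h le_rfl (by lia)

lemma form_varpi_slideRoot_height_add_one (Q : DynkinQuiver b) (i j : b.support) :
    form P (varpi b i) (slideRoot Q j (Q.ξ i + 1)) = 0 := by
  by_cases h : i = j
  · rw [← h, slideRoot_eq_zero Q (by simp), map_zero]
  · exact form_varpi_slideRoot_eq_zero Q h (by lia) le_rfl

/-- The Laurent coefficients of the inverse of `B(t)` in terms of the Coxeter element. -/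
lemma btilde_eq_form (Q : DynkinQuiver b) (i j : b.support) {u : ℤ} (hu : 0 ≤ u) :
    btilde b i j u = form P (varpi b i) (slideRoot Q j (Q.ξ i + 1 - u)) := by
  -- The recursion has order two, so the induction carries two consecutive values for all j at once.
  have key : ∀ n : ℕ, (∀ j, btilde b i j n =
      form P (varpi b i) (slideRoot Q j (Q.ξ i + 1 - n))) ∧ ∀ j, btilde b i j (n + 1) =
      form P (varpi b i) (slideRoot Q j (Q.ξ i + 1 - (n + 1))) := by
    intro n
    induction n with
    | zero =>
      refine ⟨fun j => ?_, fun j => ?_⟩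
      · rw [Nat.cast_zero, btilde_eq_zero b i j le_rfl, sub_zero,
          form_varpi_slideRoot_height_add_one]
      · rw [Nat.cast_zero, zero_add, btilde_one, add_sub_cancel_right,
          form_varpi_slideRoot_height_left]
    | succ n ih =>
      refine ⟨fun j => by rw [Nat.cast_succ]; exact ih.2 j, fun j => ?_⟩
      have h1 := btilde_mesh b i j (n + 1)
      have h2 := form_varpi_slideRoot_mesh Q i j (Q.ξ i + 1 - (n + 1))
      rw [if_neg (by lia), add_sub_cancel_right, ih.1 j,
        Finset.sum_congr rfl fun k _ => by rw [ih.2 k]] at h1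
      rw [show Q.ξ i + 1 - (n + 1) + 1 = Q.ξ i + 1 - (n : ℤ) by ring,
        show Q.ξ i + 1 - (n + 1) - 1 = Q.ξ i + 1 - ((n : ℤ) + 1 + 1) by ring] at h2
      rw [Nat.cast_succ]
      linarith
  lift u to ℕ using hu
  exact (key u).1 j

/-! ### The exponent as a pairing of roots. -/

lemma form_slideWeight_slideRoot (Q : DynkinQuiver b) (i j : b.support) {p : ℤ} (s : ℤ)
    (hp : Even (Q.ξ i - p)) : form P (slideWeight Q i p) (slideRoot Q j s) =
      form P (varpi b i) (slideRoot Q j (Q.ξ i + s - p)) := by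
  rw [slideWeight, if_pos hp, form_smul_left, ← zpow_neg, coxeter_zpow_smul_slideRoot]
  congr 2
  obtain ⟨m, hm⟩ := hp
  lia

lemma form_slideRoot_slideRoot (Q : DynkinQuiver b) (i j : b.support) {p : ℤ} (s : ℤ)
    (hp : Even (Q.ξ i - p)) : form P (slideRoot Q i p) (slideRoot Q j s) =
      form P (varpi b i) (slideRoot Q j (Q.ξ i + s - p)) -
        form P (varpi b i) (slideRoot Q j (Q.ξ i + s - p + 2)) := by
  rw [slideRoot, map_sub, LinearMap.sub_apply, form_slideWeight_slideRoot Q i j s hp,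
    form_slideWeight_slideRoot Q i j s (by grind)]
  congr 3
  ring

lemma NN_eq_neg_form (Q : DynkinQuiver b) (i j : b.support) {p s : ℤ}
    (hp : Even (Q.ξ i - p)) (hs : s < p) :
    NN b i p j s = -form P (slideRoot Q i p) (slideRoot Q j s) := by
  rw [NN_of_lt b i j hs, btilde_eq_form Q i j (by lia), btilde_eq_form Q i j (by lia),
    form_slideRoot_slideRoot Q i j s hp, neg_sub]
  congr 3 <;> ring_nf

/-- All pairings of ϖ_i at position ξ_i + 1 vanish, so the mesh relation there makes the values at
ξ_i and ξ_i + 2 opposite; for j ≠ i the first is 0. -/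
lemma form_slideRoot_slideRoot_same (Q : DynkinQuiver b) {i j : b.support} (hij : i ≠ j) {p : ℤ}
    (hp : Even (Q.ξ i - p)) : form P (slideRoot Q i p) (slideRoot Q j p) = 0 := by
  have h := form_varpi_slideRoot_mesh Q i j (Q.ξ i + 1)
  rw [add_sub_cancel_right, form_varpi_slideRoot_height_left, if_neg hij, Finset.sum_eq_zero,
    add_zero, add_zero, add_assoc] at h
  · rw [form_slideRoot_slideRoot Q i j p hp, add_sub_cancel_right,
      form_varpi_slideRoot_height_left, if_neg hij, zero_sub, neg_eq_zero]
    exact h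
  · intro k _
    rw [form_varpi_slideRoot_height_add_one, mul_zero]

/-- The root `(-1) ^ u β` attached to `(β, u)`. -/
def signedRoot (x : PosRoot b × ℤ) : M := (-1 : ℚ) ^ x.2 • P.root x.1

/-- The shift of the second coordinate records exactly the sign lost when a negative root is
replaced by its opposite, so the piecewise rule becomes the linear action of w. -/
lemma signedRoot_hat (w : P.weylGroup) (x : PosRoot b × ℤ) :
    signedRoot (hat w x) = w • signedRoot x := by
  change signedRoot (move w (-1) x) = _
  by_cases h : b.IsPos (w • (x.1 : ι))
  · simp [move, signedRoot, h, root_weyl_smul, weyl_smul_smul]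
  · simp [move, signedRoot, h, root_weyl_smul, weyl_smul_smul, root_negIdx,
      zpow_add₀ (by norm_num : (-1 : ℚ) ≠ 0)]

lemma signedRoot_hat_zpow (w : P.weylGroup) (n : ℤ) (x : PosRoot b × ℤ) :
    signedRoot ((hat w ^ n) x) = w ^ n • signedRoot x := by
  have key : ∀ (n : ℕ) (x : PosRoot b × ℤ), signedRoot ((hat w ^ n) x) = w ^ n • signedRoot x := by
    intro n
    induction n with
    | zero => simp
    | succ n ih =>
      intro x
      rw [pow_succ', pow_succ', Equiv.Perm.mul_apply, signedRoot_hat, ih, mul_smul]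
  obtain ⟨m, rfl | rfl⟩ := n.eq_nat_or_neg
  · rw [zpow_natCast, zpow_natCast, key]
  · rw [zpow_neg, zpow_neg, zpow_natCast, zpow_natCast, eq_inv_smul_iff, ← key,
      ← Equiv.Perm.mul_apply, mul_inv_cancel, Equiv.Perm.one_apply]

lemma signedRoot_phi (Q : DynkinQuiver b) (x : Vertex Q) :
    signedRoot (phi Q x) = slideRoot Q x.1.1 x.1.2 := by
  have h : Even (Q.ξ x.1.1 - x.1.2) := by
    have := x.2
    grind
  rw [phi, signedRoot_hat_zpow, slideRoot_eq Q h]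
  simp [signedRoot]

lemma NN_eq_form_signedRoot (Q : DynkinQuiver b) (x y : Vertex Q) :
    NN b x.1.1 x.1.2 y.1.1 y.1.2 = (-1) ^ (if x.1.2 ≥ y.1.2 then 1 else 0) *
      (if x ≠ y then 1 else 0) * form P (signedRoot (phi Q x)) (signedRoot (phi Q y)) := by
  have hx : Even (Q.ξ x.1.1 - x.1.2) := by have := x.2; grind
  have hy : Even (Q.ξ y.1.1 - y.1.2) := by have := y.2; grind
  rw [signedRoot_phi, signedRoot_phi]
  rcases lt_trichotomy x.1.2 y.1.2 with h | h | h
  · have hne : x ≠ y := by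
      rintro rfl
      exact lt_irrefl _ h
    rw [NN_antisymm, NN_eq_neg_form Q _ _ hy h, form_comm, if_neg (not_le.mpr h), if_pos hne]
    ring
  · rw [h, NN_self]
    by_cases hij : x.1.1 = y.1.1
    · rw [if_neg (not_not.mpr (Subtype.ext (Prod.ext hij h))), mul_zero, zero_mul]
    · rw [form_slideRoot_slideRoot_same Q hij (h ▸ hx), mul_zero]
  · have hne : x ≠ y := by
      rintro rfl
      exact lt_irrefl _ h
    rw [NN_eq_neg_form Q _ _ hx h, if_pos h.le, if_pos hne]
    ring

lemma gen_mul_gen (Q : DynkinQuiver b) (x y : Vertex Q) {n : ℤ}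
    (hn : (n : ℚ) = NN b x.1.1 x.1.2 y.1.1 y.1.2) :
    gen Q x * gen Q y = qpow n • (gen Q y * gen Q x) := by
  simp only [gen, ← map_mul, ← map_smul]
  exact RingQuot.mkAlgHom_rel GroundRing (TorusRel.comm x y n hn)

end Values

end TQuantized

end

theorem mainTheorem7 {ι M N : Type*} [Fintype ι] [DecidableEq ι]
    [AddCommGroup M] [Module ℚ M] [AddCommGroup N] [Module ℚ N]
    (P : RootPairing ι ℚ M N) [P.IsRootSystem] [P.IsCrystallographic] [P.IsReduced]
    [P.IsIrreducible] (b : P.Base) (Q : TQuantized.DynkinQuiver b)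
    (x y : TQuantized.Vertex Q) (α β : TQuantized.PosRoot b) (k l : ℤ)
    (hx : TQuantized.phi Q x = (α, k)) (hy : TQuantized.phi Q y = (β, l)) :
    TQuantized.NN b x.1.1 x.1.2 y.1.1 y.1.2 =
        (-1) ^ (k + l + if x.1.2 ≥ y.1.2 then 1 else 0) * (if x ≠ y then 1 else 0) *
          TQuantized.form P (P.root α) (P.root β) ∧
      ∃ n : ℤ, (n : ℚ) = TQuantized.NN b x.1.1 x.1.2 y.1.1 y.1.2 ∧
        TQuantized.gen Q x * TQuantized.gen Q y =
          TQuantized.qpow n • (TQuantized.gen Q y * TQuantized.gen Q x) := by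
  have h1 : TQuantized.NN b x.1.1 x.1.2 y.1.1 y.1.2 =
      (-1) ^ (k + l + if x.1.2 ≥ y.1.2 then 1 else 0) * (if x ≠ y then 1 else 0) *
        TQuantized.form P (P.root α) (P.root β) := by
    have h0 : (-1 : ℚ) ≠ 0 := by norm_num
    rw [TQuantized.NN_eq_form_signedRoot Q x y, hx, hy]
    simp only [TQuantized.signedRoot, map_smul, LinearMap.smul_apply, smul_eq_mul,
      zpow_add₀ h0]
    split_ifs <;> simp <;> ring
  refine ⟨h1, ?_⟩
  obtain ⟨m, hm⟩ := TQuantized.exists_int_form_root_root (P := P) α β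
  -- Integrality is needed because the commutation relations of the torus are indexed by integer
  -- exponents.
  have h2 : ∃ n : ℤ, (n : ℚ) = TQuantized.NN b x.1.1 x.1.2 y.1.1 y.1.2 := by
    rw [h1, ← hm]
    rcases Int.even_or_odd (k + l + if x.1.2 ≥ y.1.2 then 1 else 0) with h | h
    · exact ⟨(if x ≠ y then 1 else 0) * m, by rw [h.neg_one_zpow]; push_cast; ring⟩
    · exact ⟨-((if x ≠ y then 1 else 0) * m), by rw [h.neg_one_zpow]; push_cast; ring⟩
  obtain ⟨n, hn⟩ := h2
  exact ⟨n, hn, TQuantized.gen_mul_gen Q x y hn⟩
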